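/- A marked Petri net $\mathcal N=(P,\Theta,f,m_0)$ consists of finite sets $P$ of places and $\Theta$ of transitions, a flow function $f:(P\times\Theta)\cup(\Theta\times P)\to\mathbb N$ and an initial marking $m_0\in\mathbb N^P$. A transition $t$ can be fired in a marking $m$ if $m(p)\ge f(p,t)$ for all $p\in P$, and then leads to the marking $m'$ with $m'(p)=m(p)-f(p,t)+f(t,p)$. The free labeled Petri net $\mathcal N$ has trace set $T(\mathcal N)\subseteq\Theta^*$, the set of all finite sequences of transitions that can be fired one after the other from $m_0$. Its size is $|\mathcal N|=|P|+|\Theta|+\sum_{p\in P,\,t\in\Theta}\bigl(f(p,t)+f(t,p)\bigr)+\sum_{p\in P}m_0(p)$. A language $L\subseteq\Theta^*$ is bounded if $L\subseteq w_1^*\cdots w_k^*$ for some $k\in\mathbb N$ and words $w_1,\dots,w_k\in\Theta^*$; the size of the bounded expression $w_1^*\cdots w_k^*$ is $\sum_{i=1}^k|w_i|$. **Proposition.** There is a family $(\mathcal N_n)_{n\in\mathbb N}$ of free labeled Petri nets of linear size, that is, $n\le|\mathcal N_n|\le C(n+1)$ for some constant $C$ and all $n$, such that every trace set $T(\mathcal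 N_n)$ is bounded, and in fact finite, but the size of bounded expressions for $T(\mathcal N_n)$ is not primitive recursive in the size of $\mathcal N_n$: for every primitive recursive function $g:\mathbb N\to\mathbb N$ there is $n_0$ such that for all $n\ge n_0$ and all words $w_1,\dots,w_k$ with $T(\mathcal N_n)\subseteq w_1^*\cdots w_k^*$, $$\sum_{i=1}^k|w_i|>g(|\mathcal N_n|).$$ -/

import Mathlib

/-- A labeled transition system with states `S` and labels `A`. -/
structure LTS (S A : Type) where
  init : S
  tr : S → A → S → Prop

namespace LTS

variable {S A : Type}

/-- The extension of the transition relation to finite words. -/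
inductive Run (𝒮 : LTS S A) : S → List A → S → Prop
  | nil (s : S) : Run 𝒮 s [] s
  | cons {s s' s'' : S} {a : A} {w : List A} :
      𝒮.tr s a s' → Run 𝒮 s' w s'' → Run 𝒮 s (a :: w) s''

/-- The trace set: all words labeling a run from the initial state. -/
def traceSet (𝒮 : LTS S A) : Language A :=
  {w : List A | ∃ s : S, 𝒮.Run 𝒮.init w s}

end LTS

/-- A marked Petri net: finite sets of places and transitions, a flow function given by its two
restrictions `pre p t = f(p, t)` and `post t p = f(t, p)`, and an initial marking. -/
structure PetriNet where
  Place : Type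
  Trans : Type
  fintypePlace : Fintype Place
  fintypeTrans : Fintype Trans
  pre : Place → Trans → ℕ
  post : Trans → Place → ℕ
  init : Place → ℕ

namespace PetriNet

attribute [instance] PetriNet.fintypePlace PetriNet.fintypeTrans

abbrev Marking (N : PetriNet) : Type := N.Place → ℕ

/-- Transition `t` can be fired in the marking `m`. -/
def Enabled (N : PetriNet) (m : N.Marking) (t : N.Trans) : Prop :=
  ∀ p, N.pre p t ≤ m p

/-- The marking obtained by firing `t` in `m` (meaningful when `t` is enabled in `m`). -/
def fire (N : PetriNet) (m : N.Marking) (t : N.Trans) : N.Marking :=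
  fun p => m p - N.pre p t + N.post t p

/-- The transition system of the Petri net labeled by `σ`. -/
def labeledLTS (N : PetriNet) {A : Type} (σ : N.Trans → A) : LTS N.Marking A where
  init := N.init
  tr m a m' := ∃ t, σ t = a ∧ N.Enabled m t ∧ m' = N.fire m t

/-- The transition system of the free labeled Petri net: every transition is its own label. -/
def freeLTS (N : PetriNet) : LTS N.Marking N.Trans := N.labeledLTS id

/-- The trace set of the free labeled Petri net. -/
def traceSet (N : PetriNet) : Language N.Trans := N.freeLTS.traceSet

/-- The size of the net, with all numbers written in unary: number of places and transitions,
plus total arc weight, plus number of initial tokens. -/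
def size (N : PetriNet) : ℕ :=
  Fintype.card N.Place + Fintype.card N.Trans
    + ∑ p, ∑ t, (N.pre p t + N.post t p) + ∑ p, N.init p

end PetriNet

open scoped Computability in
/-- The language of the bounded expression `w₁∗ ⋯ wₙ∗`. -/
def boundedExpr {A : Type} (ws : List (List A)) : Language A :=
  (ws.map fun w => ({w} : Language A)∗).prod

/-- The size `∑ |wᵢ|` of the bounded expression `w₁∗ ⋯ wₙ∗`. -/
def boundedExprSize {A : Type} (ws : List (List A)) : ℕ :=
  (ws.map List.length).sum

/-- A language is bounded if it is included in the language of some bounded expression. -/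
def IsBoundedLanguage {A : Type} (L : Language A) : Prop :=
  ∃ ws : List (List A), L ≤ boundedExpr ws

/-! The net evaluates `ack n n` weakly: a run may stop early or lose tokens, but some run ends with
exactly `ack n n` tokens in the argument place (`reach_ack`). Each such token can be spent on one of
two letters, so every binary word `u` of length at most `ack n n` is the letter projection of a
trace (`exists_trace`).

All traces together are finitely many, since each firing lowers a lexicographic rank (`step_rank`)
and branching is finite.

A bounded expression of size `s` yields at most `(m + 1) ^ s` projections of length at most `m`
(`exists_finset_boundedExpr`). Covering all binary words of length `m` thus forces `2 ^ m ≤ (m + 1)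
^ s`, so `s` is at least about `m / log m`. As `m` may be taken close to `ack n n`, which outgrows
every primitive recursive function of the linear net size, `s` does too. -/

/-! ### Finiteness of trace sets from a well-founded rank -/

namespace LTS

variable {S A : Type} {𝒮 : LTS S A}

theorem Run.append {s s' s'' : S} {u v : List A} (h : 𝒮.Run s u s') (h' : 𝒮.Run s' v s'') :
    𝒮.Run s (u ++ v) s'' := by
  induction h with
  | nil s => exact h'
  | cons h₁ _ ih => exact .cons h₁ (ih h')

theorem Run.single {s s' : S} {a : A} (h : 𝒮.tr s a s') : 𝒮.Run s [a] s' :=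
  .cons h (.nil _)

/-- If every deterministic step inside an invariant decreases a well-founded rank, then only
finitely many words can be read from a state satisfying the invariant. -/
theorem finite_words_of_rank [Finite A] {X R : Type} {r : R → R → Prop} (hr : WellFounded r)
    (enc : X → S) (rank : X → R) (next : S → A → S)
    (hdet : ∀ s a s', 𝒮.tr s a s' → s' = next s a)
    (hstep : ∀ x a s', 𝒮.tr (enc x) a s' → ∃ y, s' = enc y ∧ r (rank y) (rank x)) (x : X) :
    {w : List A | ∃ s, 𝒮.Run (enc x) w s}.Finite := by
  induction hx : rank x using hr.induction generalizing x with
  | _ o ih =>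
    subst hx
    have key : {w : List A | ∃ s, 𝒮.Run (enc x) w s} ⊆ {[]} ∪ ⋃ a : A, (fun w => a :: w) ''
        {w | 𝒮.tr (enc x) a (next (enc x) a) ∧ ∃ s, 𝒮.Run (next (enc x) a) w s} := by
      rintro w ⟨s, h⟩
      cases h with
      | nil => simp
      | @cons _ s' _ a w h₁ h₂ =>
        right
        obtain rfl := hdet _ _ _ h₁
        exact Set.mem_iUnion.2 ⟨a, w, ⟨h₁, s, h₂⟩, rfl⟩
    refine ((Set.finite_singleton _).union (Set.finite_iUnion fun a =>
      Set.Finite.image _ ?_)).subset key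
    by_cases h : 𝒮.tr (enc x) a (next (enc x) a)
    · obtain ⟨y, hy, hlt⟩ := hstep _ _ _ h
      refine (ih _ hlt y rfl).subset ?_
      rw [hy]
      exact fun w hw => hw.2
    · simp [h]

end LTS

/-! ### Counting words in bounded expressions -/

section Bounded

open scoped Computability

variable {A : Type}

theorem mem_kstar_singleton {w v : List A} :
    v ∈ ({w} : Language A)∗ ↔ ∃ e : ℕ, v = (List.replicate e w).flatten := by
  rw [Language.mem_kstar]
  constructor
  · rintro ⟨l, rfl, hl⟩
    exact ⟨l.length, by rw [← List.eq_replicate_of_mem fun y hy => hl y hy]⟩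
  · rintro ⟨e, rfl⟩
    exact ⟨_, rfl, fun y hy => List.eq_of_mem_replicate hy⟩

theorem mem_boundedExpr_cons {w v : List A} {ws : List (List A)} :
    v ∈ boundedExpr (w :: ws) ↔
      ∃ (e : ℕ) (v' : List A), v' ∈ boundedExpr ws ∧ (List.replicate e w).flatten ++ v' = v := by
  simp only [boundedExpr, List.map_cons, List.prod_cons, Language.mem_mul, mem_kstar_singleton]
  constructor
  · rintro ⟨_, ⟨e, rfl⟩, v', h, rfl⟩
    exact ⟨e, v', h, rfl⟩
  · rintro ⟨e, v', h, rfl⟩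
    exact ⟨_, ⟨e, rfl⟩, v', h, rfl⟩

theorem nil_mem_boundedExpr (ws : List (List A)) : [] ∈ boundedExpr ws := by
  induction ws with
  | nil => simp [boundedExpr, Language.mem_one]
  | cons w ws ih => exact mem_boundedExpr_cons.2 ⟨0, [], ih, by simp⟩

theorem mem_boundedExpr_of_mem {w : List A} {ws : List (List A)} (h : w ∈ ws) :
    w ∈ boundedExpr ws := by
  induction ws with
  | nil => simp at h
  | cons v ws ih =>
    rcases List.mem_cons.1 h with rfl | h
    · exact mem_boundedExpr_cons.2 ⟨1, [], nil_mem_boundedExpr ws, by simp⟩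
    · exact mem_boundedExpr_cons.2 ⟨0, w, ih h, by simp⟩

theorem isBoundedLanguage_of_finite {L : Language A} (h : {w : List A | w ∈ L}.Finite) :
    IsBoundedLanguage L :=
  ⟨h.toFinset.toList, fun _ hw => mem_boundedExpr_of_mem
    (Finset.mem_toList.2 (h.mem_toFinset.2 hw))⟩

theorem filterMap_flatten_replicate {B : Type} (f : A → Option B) (e : ℕ) (w : List A) :
    (List.replicate e w).flatten.filterMap f = (List.replicate e (w.filterMap f)).flatten := by
  induction e with
  | zero => simp
  | succ e ih => simp [List.replicate_succ, ih]

/-- Polynomial growth of (projections of) bounded expressions. -/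
theorem exists_finset_boundedExpr {B : Type} [DecidableEq B] (f : A → Option B) (m : ℕ)
    (ws : List (List A)) :
    ∃ F : Finset (List B), (∀ v ∈ boundedExpr ws, (v.filterMap f).length ≤ m → v.filterMap f ∈ F) ∧
      F.card ≤ (m + 1) ^ boundedExprSize ws := by
  induction ws with
  | nil =>
    refine ⟨{[]}, fun v hv _ => ?_, by simpa using Nat.one_le_pow _ _ (by omega)⟩
    have : v = [] := by simpa [boundedExpr, Language.mem_one] using hv
    simp [this]
  | cons w ws ih =>
    obtain ⟨F, hF, hc⟩ := ih
    have hsize : boundedExprSize (w :: ws) = w.length + boundedExprSize ws := by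
      simp [boundedExprSize]
    -- If `w` projects to the empty word, its exponent is unbounded but invisible. Otherwise the
    -- exponent is at most `m`, and the factor `m + 1` is paid for by `1 ≤ w.length`.
    by_cases hw : w.filterMap f = []
    · refine ⟨F, fun v hv hl => ?_, hc.trans ?_⟩
      · obtain ⟨e, v', hv', rfl⟩ := mem_boundedExpr_cons.1 hv
        have : ((List.replicate e w).flatten ++ v').filterMap f = v'.filterMap f := by
          rw [List.filterMap_append, filterMap_flatten_replicate, hw]
          simp
        rw [this] at hl ⊢
        exact hF v' hv' hl
      · exact Nat.pow_le_pow_right (by omega) (by omega)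
    · refine ⟨(Finset.range (m + 1)).biUnion fun e =>
        F.image fun u => (List.replicate e (w.filterMap f)).flatten ++ u, fun v hv hl => ?_, ?_⟩
      · obtain ⟨e, v', hv', rfl⟩ := mem_boundedExpr_cons.1 hv
        rw [List.filterMap_append, filterMap_flatten_replicate] at hl ⊢
        have hpos : 1 ≤ (w.filterMap f).length := List.length_pos_iff.2 hw
        have hl' : e * (w.filterMap f).length + (v'.filterMap f).length ≤ m := by
          simpa using hl
        have he : e ≤ e * (w.filterMap f).length := Nat.le_mul_of_pos_right _ hpos
        exact Finset.mem_biUnion.2 ⟨e, Finset.mem_range.2 (by omega),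
          Finset.mem_image.2 ⟨_, hF v' hv' (by omega), rfl⟩⟩
      · have hpos : 1 ≤ w.length := by
          rcases w with _ | _
          · simp at hw
          · simp
        calc _ ≤ ∑ e ∈ Finset.range (m + 1), (m + 1) ^ boundedExprSize ws :=
              Finset.card_biUnion_le.trans
                (Finset.sum_le_sum fun e _ => Finset.card_image_le.trans hc)
          _ = (m + 1) ^ (1 + boundedExprSize ws) := by simp [pow_add]
          _ ≤ _ := Nat.pow_le_pow_right (by omega) (by omega)

/-- A bounded expression whose projection covers all binary words of length `m` is large. -/
theorem two_pow_le_of_binary_words (f : A → Option Bool) (m : ℕ) (ws : List (List A))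
    (h : ∀ u : List Bool, u.length = m → ∃ v ∈ boundedExpr ws, v.filterMap f = u) :
    2 ^ m ≤ (m + 1) ^ boundedExprSize ws := by
  obtain ⟨F, hF, hc⟩ := exists_finset_boundedExpr f m ws
  refine le_trans ?_ hc
  have : (Finset.univ.image (List.ofFn : (Fin m → Bool) → List Bool)).card = 2 ^ m := by
    rw [Finset.card_image_of_injective _ List.ofFn_injective]
    simp
  rw [← this]
  refine Finset.card_le_card fun u hu => ?_
  obtain ⟨φ, -, rfl⟩ := Finset.mem_image.1 hu
  obtain ⟨v, hv, hvu⟩ := h (List.ofFn φ) (by simp)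
  rw [← hvu]
  exact hF v hv (by simp [hvu])

/-- With `m + 1` a power of two, comparing exponents gives `m ≤ 4 * (G + 1) * s`. For `s ≤ G` this
fails because `m + 1 ≥ (G + 2) ^ 4`. -/
theorem lt_of_two_pow_le {G s : ℕ}
    (h : 2 ^ (2 ^ (4 * (G + 1)) - 1) ≤ (2 ^ (4 * (G + 1)) - 1 + 1) ^ s) : G < s := by
  by_contra! hs
  rw [Nat.sub_add_cancel Nat.one_le_two_pow, ← pow_mul] at h
  have h1 := (Nat.pow_le_pow_iff_right (by norm_num)).1 h
  have h2 : 4 * (G + 1) * s ≤ 4 * (G + 1) * G := Nat.mul_le_mul_left _ hs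
  have h3 : G + 2 ≤ 2 ^ (G + 1) := Nat.lt_two_pow_self
  have h4 : (G + 2) ^ 4 ≤ 2 ^ (4 * (G + 1)) := by
    rw [mul_comm, pow_mul]
    exact Nat.pow_le_pow_left h3 4
  have h5 : 4 * (G + 1) * G + 1 < (G + 2) ^ 4 := by ring_nf; nlinarith [sq_nonneg G]
  omega

end Bounded

/-- Both primitive recursive bounds lie below fixed levels of `ack`; their composition lies below
one fixed level, which the diagonal overtakes. -/
theorem exists_primrec_comp_lt_ack (g : ℕ → ℕ) (hg : Primrec g) (C : ℕ) :
    ∃ n₀, ∀ n, n₀ ≤ n → ∀ s ≤ C * (n + 1), 2 ^ (4 * (g s + 1)) ≤ ack n n := by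
  have hp : Primrec fun x => 2 ^ (4 * (g x + 1)) :=
    Primrec.nat_iff.2 <| (Nat.Primrec.pow.comp
      (.pair (.const 2) (Nat.Primrec.mul.comp (.pair (.const 4) (.comp .succ
        (Primrec.nat_iff.1 hg)))))).of_eq fun n => by simp
  have hl : Nat.Primrec fun n => C * (n + 1) :=
    (Nat.Primrec.mul.comp (.pair (.const C) .succ)).of_eq fun n => by simp
  obtain ⟨a, ha⟩ := exists_lt_ack_of_nat_primrec (Primrec.nat_iff.1 hp)
  obtain ⟨b, hb⟩ := exists_lt_ack_of_nat_primrec hl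
  refine ⟨max a b + 2, fun n hn s hs => ?_⟩
  calc 2 ^ (4 * (g s + 1)) ≤ ack a s := (ha s).le
    _ ≤ ack a (ack b n) := ack_mono_right a (hs.trans (hb n).le)
    _ ≤ ack (max a b + 2) n := (ack_ack_lt_ack_max_add_two a b n).le
    _ ≤ ack n n := ack_mono_left n hn

/-! ### The Ackermann net and its size -/

namespace AckNet

variable {n : ℕ}

/-- Places: control places (`none` is the main one, `some k` the loop of level `k`) and counters
(the argument of the Ackermann function at `0`, the pending calls of level `k` at `k + 1`). -/
abbrev Place (n : ℕ) : Type := Option (Fin n) ⊕ Fin (n + 2)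

/-- Transitions: `enter k`, `move k` and `exit k` for each level `k`, then one transition `none`
for calls of the level `0`, and two letters that consume the result. -/
abbrev Trans (n : ℕ) : Type := Fin n ⊕ Fin n ⊕ Fin n ⊕ Option Bool

/-- The marking with control `q` and counters `d`. -/
def enc (q : Option (Fin n)) (d : Fin (n + 2) → ℕ) : Place n → ℕ := Sum.elim (Pi.single q 1) d

/-- Letters use no control place, so they can also fire in the middle of the evaluation. -/
def input : Trans n → Place n → ℕ
  | .inl k => enc none (Pi.single k.succ.succ 1)
  | .inr (.inl k) => enc (some k) (Pi.single 0 1)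
  | .inr (.inr (.inl k)) => enc (some k) 0
  | .inr (.inr (.inr none)) => enc none (Pi.single 1 1)
  | .inr (.inr (.inr (some _))) => Sum.elim 0 (Pi.single 0 1)

def output : Trans n → Place n → ℕ
  | .inl k => enc (some k) 0
  | .inr (.inl k) => enc (some k) (Pi.single k.castSucc.succ 1)
  | .inr (.inr (.inl k)) => enc none (Pi.single k.castSucc.succ 1 + Pi.single 0 1)
  | .inr (.inr (.inr none)) => enc none (Pi.single 0 1)
  | .inr (.inr (.inr (some _))) => 0

/-- The net whose main control place runs the evaluation of `ack n n`. -/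
def net (n : ℕ) : PetriNet where
  Place := Place n
  Trans := Trans n
  fintypePlace := inferInstance
  fintypeTrans := inferInstance
  pre p t := input t p
  post t p := output t p
  init := enc none (Pi.single (Fin.last (n + 1)) 1 + Pi.single 0 n)

theorem sum_enc (q : Option (Fin n)) (d : Fin (n + 2) → ℕ) : ∑ p, enc q d p = 1 + ∑ i, d i := by
  simp [enc, Fintype.sum_sum_type]

theorem sum_arcs_le (t : Trans n) : ∑ p, (input t p + output t p) ≤ 4 := by
  rw [Finset.sum_add_distrib]
  rcases t with k | k | k | _ | b
  iterate 4
    simp only [input, output, sum_enc]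
    simp [Finset.sum_add_distrib]
  simp [input, output]

theorem size_net_bounds : n ≤ (net n).size ∧ (net n).size ≤ 30 * (n + 1) := by
  have h1 : Fintype.card (net n).Place = n + 1 + (n + 2) := by
    change Fintype.card (Place n) = _
    simp
  have h2 : Fintype.card (net n).Trans = n + (n + (n + 3)) := by
    change Fintype.card (Trans n) = _
    simp
  have h3 : ∑ p, (net n).init p = 1 + (1 + n) := by
    change ∑ p, enc none (Pi.single (Fin.last (n + 1)) 1 + Pi.single 0 n) p = _
    rw [sum_enc]
    simp [Finset.sum_add_distrib]
  have h4 : ∑ p, ∑ t, ((net n).pre p t + (net n).post t p) ≤ (n + (n + (n + 3))) * 4 := by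
    rw [Finset.sum_comm, ← h2]
    exact Finset.sum_le_card_nsmul _ _ 4 fun t _ => sum_arcs_le t
  unfold PetriNet.size
  omega

theorem enc_le_enc {q p : Option (Fin n)} {d e : Fin (n + 2) → ℕ} :
    (∀ x, enc q e x ≤ enc p d x) ↔ q = p ∧ e ≤ d := by
  constructor
  · intro h
    refine ⟨?_, fun i => h (.inr i)⟩
    by_contra hne
    have := h (.inl q)
    simp [enc, hne] at this
  · rintro ⟨rfl, h⟩ (x | x)
    · simp [enc]
    · exact h x

theorem tr_iff {m m' : Place n → ℕ} {t : Trans n} :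
    (net n).freeLTS.tr m t m' ↔ (∀ p, input t p ≤ m p) ∧ m' = m - input t + output t := by
  constructor
  · rintro ⟨_, rfl, h, rfl⟩
    exact ⟨h, rfl⟩
  · rintro ⟨h, rfl⟩
    exact ⟨t, rfl, h, rfl⟩

theorem enc_sub_add (q q' : Option (Fin n)) (d e e' : Fin (n + 2) → ℕ) :
    enc q (d + e) - enc q e + enc q' e' = enc q' (d + e') := by
  ext (x | x) <;> simp [enc]

theorem enc_sub_letter (q : Option (Fin n)) (d : Fin (n + 2) → ℕ) (b : Bool) :
    enc q (d + Pi.single 0 1) - input (.inr (.inr (.inr (some b)))) +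
      output (.inr (.inr (.inr (some b)))) = enc q d := by
  funext x
  rcases x with x | x
  · simp [enc, input, output]
  · exact Nat.add_sub_cancel (d x) ((Pi.single 0 1 : Fin (n + 2) → ℕ) x)

/-! ### Termination of the net -/

/-- Ranks are compared lexicographically, high indices first. -/
def rank : Option (Fin n) → (Fin (n + 2) → ℕ) → Fin (n + 2) → ℕ
  | none, d => d
  | some k, d => Function.update d k.castSucc.succ (d k.castSucc.succ + d 0 + 2)

def RankLT (d e : Fin (n + 2) → ℕ) : Prop := ∃ i, (∀ j, i < j → d j = e j) ∧ d i < e i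

theorem wellFounded_rankLT : WellFounded (RankLT (n := n)) :=
  Pi.Lex.wellFounded (ι := Fin (n + 2)) (α := fun _ => ℕ) (· > ·) (s := fun _ => (· < ·))
    fun _ => wellFounded_lt

/-- In loop `k` the rank counts argument tokens as if already moved to level `k`, so `move` keeps
that coordinate and lowers index `0`. The summand `2` exceeds the single call added by `exit`.
`enter` lowers the higher index `k + 2`, whatever happens below it. -/
theorem step_rank (q : Option (Fin n)) (d : Fin (n + 2) → ℕ) (t : Trans n) (m : Place n → ℕ)
    (h : (net n).freeLTS.tr (enc q d) t m) :
    ∃ q' d', m = enc q' d' ∧ RankLT (rank q' d') (rank q d) := by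
  obtain ⟨h', rfl⟩ := tr_iff.1 h
  clear h
  rcases t with k | k | k | _ | b
  · obtain ⟨rfl, hd⟩ := enc_le_enc.1 h'
    obtain ⟨f, rfl⟩ := le_iff_exists_add'.1 hd
    refine ⟨_, _, enc_sub_add _ _ _ _ _, k.succ.succ, fun j hj => ?_, ?_⟩
    · have h1 : j ≠ k.succ.succ := hj.ne'
      have h2 : j ≠ k.castSucc.succ := by
        rintro rfl; simp [Fin.lt_def] at hj
      simp [rank, h1, h2]
    · have h2 : k.succ.succ ≠ k.castSucc.succ := by
        simp [Fin.ext_iff]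
      simp [rank, h2]
  · obtain ⟨rfl, hd⟩ := enc_le_enc.1 h'
    obtain ⟨f, rfl⟩ := le_iff_exists_add'.1 hd
    refine ⟨_, _, enc_sub_add _ _ _ _ _, 0, fun j hj => ?_, ?_⟩
    · by_cases h2 : j = k.castSucc.succ
      · subst h2
        simp [rank]
        omega
      · simp [rank, h2, hj.ne']
    · simp [rank, Fin.ext_iff]
  · obtain ⟨rfl, hd⟩ := enc_le_enc.1 h'
    obtain ⟨f, rfl⟩ := le_iff_exists_add'.1 hd
    refine ⟨_, _, enc_sub_add _ _ _ _ _, k.castSucc.succ, fun j hj => ?_, ?_⟩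
    · have h1 : j ≠ 0 := ((Fin.zero_le _).trans_lt hj).ne'
      simp [rank, h1, hj.ne']
    · simp [rank]
  · obtain ⟨rfl, hd⟩ := enc_le_enc.1 h'
    obtain ⟨f, rfl⟩ := le_iff_exists_add'.1 hd
    refine ⟨_, _, enc_sub_add _ _ _ _ _, 1, fun j hj => ?_, ?_⟩
    · have h1 : j ≠ 0 := ((Fin.zero_le _).trans_lt hj).ne'
      simp [rank, h1, hj.ne']
    · simp [rank]
  · have hd : (Pi.single 0 1 : Fin (n + 2) → ℕ) ≤ d := fun i => h' (.inr i)
    obtain ⟨f, rfl⟩ := le_iff_exists_add'.1 hd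
    refine ⟨q, f, enc_sub_letter q f b, ?_⟩
    cases q with
    | none =>
      refine ⟨0, fun j hj => ?_, ?_⟩
      · simp [rank, hj.ne']
      · simp [rank]
    | some k =>
      refine ⟨k.castSucc.succ, fun j hj => ?_, ?_⟩
      · have h1 : j ≠ 0 := ((Fin.zero_le _).trans_lt hj).ne'
        simp [rank, h1, hj.ne']
      · simp [rank]

theorem finite_traceSet (n : ℕ) : {w : List (Trans n) | w ∈ (net n).traceSet}.Finite := by
  have h := LTS.finite_words_of_rank (𝒮 := (net n).freeLTS) (A := Trans n) wellFounded_rankLT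
    (fun x : Option (Fin n) × (Fin (n + 2) → ℕ) => enc x.1 x.2) (fun x => rank x.1 x.2)
    (fun (m : Place n → ℕ) (t : Trans n) => (m - input t + output t : Place n → ℕ))
    (fun _ _ _ h => (tr_iff.1 h).2)
    (fun x t m h => by
      obtain ⟨q, d, h1, h2⟩ := step_rank x.1 x.2 t m h
      exact ⟨(q, d), h1, h2⟩)
  exact h (none, Pi.single (Fin.last (n + 1)) 1 + Pi.single 0 n)

/-! ### Faithful evaluation and the binary words it makes available -/

/-- The letter, if any, that a transition stands for. -/
def letter : Trans n → Option Bool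
  | .inr (.inr (.inr t)) => t
  | _ => none

/-- Reachability, without letters, between markings given by control and counters. -/
def Reach (q : Option (Fin n)) (d : Fin (n + 2) → ℕ) (q' : Option (Fin n))
    (d' : Fin (n + 2) → ℕ) : Prop :=
  ∃ w : List (Trans n), w.filterMap letter = [] ∧ (net n).freeLTS.Run (enc q d) w (enc q' d')

theorem Reach.trans {q q' q'' : Option (Fin n)} {d d' d'' : Fin (n + 2) → ℕ}
    (h : Reach q d q' d') (h' : Reach q' d' q'' d'') : Reach q d q'' d'' := by
  obtain ⟨u, hu, hru⟩ := h
  obtain ⟨v, hv, hrv⟩ := h'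
  exact ⟨u ++ v, by simp [hu, hv], hru.append hrv⟩

theorem reach_of_transition (t : Trans n) (ht : letter t = none) {q q' : Option (Fin n)}
    {e e' : Fin (n + 2) → ℕ} (hi : input t = enc q e) (ho : output t = enc q' e')
    (d : Fin (n + 2) → ℕ) : Reach q (d + e) q' (d + e') := by
  refine ⟨[t], by simp [ht], .single (tr_iff.2 ⟨?_, ?_⟩)⟩
  · rw [hi]
    exact enc_le_enc.2 ⟨rfl, le_add_self⟩
  · rw [hi, ho, enc_sub_add]

theorem reach_move (k : Fin n) (d : Fin (n + 2) → ℕ) (r : ℕ) :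
    Reach (some k) (d + Pi.single 0 r) (some k) (d + Pi.single k.castSucc.succ r) := by
  induction r generalizing d with
  | zero =>
    refine ⟨[], rfl, ?_⟩
    rw [Pi.single_zero, Pi.single_zero]
    exact .nil _
  | succ r ih =>
    have h1 := reach_of_transition (.inr (.inl k)) rfl rfl rfl (d + Pi.single 0 r)
    have h2 := ih (d + Pi.single k.castSucc.succ 1)
    rw [add_assoc, ← Pi.single_add] at h1
    rw [add_right_comm, add_assoc d (Pi.single k.castSucc.succ 1), ← Pi.single_add,
      add_comm 1 r] at h2
    exact h1.trans h2

/-- `ack (k + 1) r` applies `ack k` to `1` exactly `r + 1` times: `move` turns the `r` argument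
tokens into calls of level `k`, and `exit` supplies one more call and the argument `1`. The
arbitrary context `d` carries the calls still waiting. -/
theorem reach_ack (k : ℕ) (hk : k < n + 1) (d : Fin (n + 2) → ℕ) (r : ℕ) :
    Reach none (d + Pi.single (Fin.succ ⟨k, hk⟩) 1 + Pi.single 0 r)
      none (d + Pi.single 0 (ack k r)) := by
  induction k generalizing d r with
  | zero =>
    have h := reach_of_transition (n := n) (.inr (.inr (.inr none))) rfl rfl rfl (d + Pi.single 0 r)
    rw [ack_zero, Pi.single_add, ← add_assoc]
    rw [add_right_comm] at h
    exact h
  | succ k ih =>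
    let κ : Fin n := ⟨k, by omega⟩
    have loop : ∀ (r : ℕ) (d : Fin (n + 2) → ℕ),
        Reach none (d + Pi.single κ.castSucc.succ (r + 1) + Pi.single 0 1)
          none (d + Pi.single 0 (ack (k + 1) r)) := by
      intro r
      induction r with
      | zero =>
        intro d
        rw [ack_succ_zero]
        exact ih _ d 1
      | succ r ihr =>
        intro d
        rw [ack_succ_succ]
        -- One call is set aside in the context while the others compute `ack (k + 1) r`; it is then
        -- applied to that result.
        refine Reach.trans ?_ (ih (by omega) d _)
        have h := ihr (d + Pi.single κ.castSucc.succ 1)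
        rw [add_assoc d, ← Pi.single_add, add_comm 1] at h
        exact h
    have h1 := reach_of_transition (.inl κ) rfl rfl rfl (d + Pi.single 0 r)
    have h2 := reach_move κ d r
    have h3 := reach_of_transition (.inr (.inr (.inl κ))) rfl rfl rfl
      (d + Pi.single κ.castSucc.succ r)
    have h4 := loop r d
    rw [add_right_comm] at h1
    rw [add_zero] at h1 h3
    rw [← add_assoc, add_assoc d, ← Pi.single_add] at h3
    exact ((h1.trans h2).trans h3).trans h4

theorem run_letters (u : List Bool) (d : Fin (n + 2) → ℕ) :
    (net n).freeLTS.Run (enc none (d + Pi.single 0 u.length))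
      (u.map fun b => (.inr (.inr (.inr (some b))) : Trans n)) (enc none d) := by
  induction u with
  | nil =>
    rw [List.length_nil, Pi.single_zero, add_zero]
    exact .nil _
  | cons b u ih =>
    refine .cons (tr_iff.2 ⟨?_, ?_⟩) ih
    · rintro (x | x)
      · simp [input]
      · rw [List.length_cons, Pi.single_add, ← add_assoc]
        exact le_add_self (a := (Pi.single 0 1 : Fin (n + 2) → ℕ) x)
    · rw [List.length_cons, Pi.single_add, ← add_assoc]
      exact (enc_sub_letter _ _ _).symm

theorem filterMap_letter (u : List Bool) :
    (u.map fun b => (.inr (.inr (.inr (some b))) : Trans n)).filterMap letter = u := by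
  induction u with
  | nil => rfl
  | cons b u ih => simpa [letter] using ih

theorem exists_trace (u : List Bool) (hu : u.length ≤ ack n n) :
    ∃ w : List (Trans n), w ∈ (net n).traceSet ∧ w.filterMap letter = u := by
  obtain ⟨w, hl, hw⟩ := reach_ack n (Nat.lt_succ_self n) 0 n
  obtain ⟨j, hj⟩ := exists_add_of_le hu
  have h := run_letters u (Pi.single 0 j : Fin (n + 2) → ℕ)
  rw [← Pi.single_add, add_comm j, ← hj] at h
  rw [zero_add, zero_add] at hw
  have key : (w ++ u.map fun b => (.inr (.inr (.inr (some b))) : Trans n)).filterMap letter =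
      u := by
    rw [List.filterMap_append, hl, filterMap_letter, List.nil_append]
  exact ⟨_, ⟨_, hw.append h⟩, key⟩

end AckNet

theorem mainTheorem12 :
    ∃ N : ℕ → PetriNet,
      (∃ C : ℕ, ∀ n : ℕ, n ≤ (N n).size ∧ (N n).size ≤ C * (n + 1)) ∧
      (∀ n : ℕ, IsBoundedLanguage (N n).traceSet ∧
        {w : List (N n).Trans | w ∈ (N n).traceSet}.Finite) ∧
      (∀ g : ℕ → ℕ, Primrec g → ∃ n₀ : ℕ, ∀ n : ℕ, n₀ ≤ n →
        ∀ ws : List (List (N n).Trans),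
          (N n).traceSet ≤ boundedExpr ws → g (N n).size < boundedExprSize ws) := by
  refine ⟨AckNet.net, ⟨30, fun n => AckNet.size_net_bounds⟩, fun n =>
    ⟨isBoundedLanguage_of_finite (AckNet.finite_traceSet n), AckNet.finite_traceSet n⟩,
    fun g hg => ?_⟩
  obtain ⟨n₀, h₀⟩ := exists_primrec_comp_lt_ack g hg 30
  refine ⟨n₀, fun n hn ws hws => lt_of_two_pow_le ?_⟩
  have hle := h₀ n hn _ AckNet.size_net_bounds.2
  refine two_pow_le_of_binary_words AckNet.letter _ ws fun u hu => ?_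
  obtain ⟨w, hw, hwu⟩ := AckNet.exists_trace (n := n) u (hu ▸ (Nat.sub_le _ 1).trans hle)
  exact ⟨w, hws hw, hwu⟩
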